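/- All rings are associative with identity, and subrings contain the identity of the ambient ring. For a ring $A$, let $J(A)$ denote its Jacobson radical, $U(A)$ its group of units, and $C(A)$ its center. A maximal subring of $A$ is a proper subring $S\subsetneq A$ such that no subring lies strictly between $S$ and $A$. Let $T$ be a ring that is integral over its center, i.e. every $t\in T$ satisfies $t^n+c_{n-1}t^{n-1}+\cdots+c_1t+c_0=0$ for some $n\ge 1$ and $c_0,\dots,c_{n-1}\in C(T)$. Let $R$ be a subring of $T$ with $J(T)\cap R\subseteq J(R)$. Then either $T$ has a maximal subring, or both $J(R)=J(T)\cap R$ and $U(R)=U(T)\cap R$. -/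

import Mathlib

/-! Suppose `T` has no maximal subring. By Zorn, no proper subring generates `T` together with
finitely many elements; no quotient of `T` has a maximal subring either. Idealizers then force every
maximal left ideal L to be two-sided, and a noncommutative T/L, algebraic over its center, would be
finitely generated over a centralizer (`exists_isCoatom_of_notMem_center`). So every T/L is a field
and T/J(T) is commutative.

In the commutative case, if a unit x ∈ R had no inverse in R, this would persist in the fraction
field K of some domain quotient, and K has a subring V with x ∈ V, x⁻¹ ∉ V, V[x⁻¹] = K
(`exists_forall_exists_pow_mul_mem`). The preimage of V is proper and generates the ring together
with x⁻¹, a contradiction. Applied modulo L and modulo J(T), this gives the two equalities. -/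

open Polynomial in
/-- Division with remainder by `X - C a` of a polynomial with central coefficients. -/
theorem Polynomial.exists_X_sub_C_mul_add_C_of_center {D : Type*} [Ring D] (a : D)
    (g : (Subring.center D)[X]) :
    ∃ z : D[X], g.map (algebraMap (Subring.center D) D) = (X - C a) * z + C (aeval a g) := by
  induction g using Polynomial.induction_on' with
  | add p q hp hq =>
    obtain ⟨y, hy⟩ := hp
    obtain ⟨z, hz⟩ := hq
    refine ⟨y + z, ?_⟩
    rw [Polynomial.map_add, hy, hz, map_add, map_add, mul_add]
    abel
  | monomial n c =>
    have hcomm : Commute (X : D[X]) (C a) := X_mul_C a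
    have hc : C (c : D) * (X - C a) = (X - C a) * C (c : D) := by
      have := Subring.mem_center_iff.mp c.2 a
      rw [mul_sub, sub_mul, X_mul_C, ← C_mul, ← C_mul, this]
    refine ⟨C (c : D) * ∑ i ∈ Finset.range n, X ^ i * (C a) ^ (n - 1 - i), ?_⟩
    rw [← mul_assoc, ← hc, mul_assoc, hcomm.mul_geom_sum₂, map_monomial, aeval_monomial,
      ← C_mul_X_pow_eq_monomial, mul_sub, ← C_pow, ← C_mul]
    exact (sub_add_cancel _ _).symm

theorem Polynomial.map_center_mul_C {D : Type*} [Ring D] (t : D)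
    (g : Polynomial (Subring.center D)) :
    g.map (algebraMap (Subring.center D) D) * C t =
      C t * g.map (algebraMap (Subring.center D) D) := by
  ext n
  rw [coeff_mul_C, coeff_C_mul, coeff_map]
  exact (Subring.mem_center_iff.mp (g.coeff n).2 t).symm

/-! ### Sources of maximal subrings -/

namespace Subring

/-- A proper subring over which the ring is finitely generated lies in a maximal subring. -/
theorem exists_isCoatom_of_sup_closure_eq_top {T : Type*} [Ring T] {S : Subring T} (hS : S ≠ ⊤)
    {s : Set T} (hs : s.Finite) (h : S ⊔ closure s = ⊤) : ∃ M : Subring T, IsCoatom M := by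
  have key : ∀ U : Subring T, S ≤ U → s ⊆ U → U = ⊤ := fun U hU hsU ↦
    top_le_iff.mp (h ▸ sup_le hU (closure_le.mpr hsU))
  -- Finiteness of `s` makes Zorn work: if the union of a chain contains `s`, so does one member.
  obtain ⟨M, hSM, hM⟩ := zorn_le_nonempty₀ {U : Subring T | S ≤ U ∧ ¬ s ⊆ U} (by
    intro c hc hchain y hy
    have hdir := hchain.directedOn
    refine ⟨sSup c, ⟨(hc hy).1.trans (le_sSup hy), fun hsub ↦ ?_⟩, fun z hz ↦ le_sSup hz⟩
    rw [coe_sSup_of_directedOn ⟨y, hy⟩ hdir] at hsub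
    rw [← Set.sUnion_image] at hsub
    obtain ⟨-, ⟨U, hU, rfl⟩, hsU⟩ :=
      DirectedOn.exists_mem_subset_of_finite_of_subset_sUnion (Set.Nonempty.image _ ⟨y, hy⟩)
        (hdir.mono_comp (rb := (· ≤ ·)) (fun _ _ h ↦ h)) hs hsub
    exact (hc hU).2 hsU) S ⟨le_rfl, fun hsS ↦ hS (key S le_rfl hsS)⟩
  refine ⟨M, fun hM' ↦ hM.prop.2 (by simp [hM']), fun U hU ↦ ?_⟩
  refine key U (hSM.trans hU.le) ?_
  by_contra hsU
  exact hU.not_ge (hM.le_of_ge ⟨hSM.trans hU.le, hsU⟩ hU.le)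

/-- Maximal subrings pull back along surjective ring homomorphisms. -/
theorem exists_isCoatom_of_surjective {A B : Type*} [Ring A] [Ring B] (f : A →+* B)
    (hf : Function.Surjective f) (h : ∃ S : Subring B, IsCoatom S) :
    ∃ S : Subring A, IsCoatom S := by
  obtain ⟨S, hS, hmax⟩ := h
  refine ⟨S.comap f, fun h ↦ hS ?_, fun U hU ↦ ?_⟩
  · refine eq_top_iff.mpr fun b _ ↦ ?_
    obtain ⟨a, rfl⟩ := hf b
    exact (h ▸ mem_top a : a ∈ S.comap f)
  · have hker : ∀ a, f a ∈ U.map f → a ∈ U := by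
      rintro a ⟨u, hu, hau⟩
      have : a - u ∈ U := hU.le (by simp [mem_comap, hau])
      simpa using add_mem this hu
    have hlt : S < U.map f := by
      refine lt_of_le_of_ne (fun b hb ↦ ?_) (fun h ↦ hU.not_ge fun u hu ↦ ?_)
      · obtain ⟨a, rfl⟩ := hf b
        exact ⟨a, hU.le hb, rfl⟩
      · rw [mem_comap, h]
        exact ⟨u, hu, rfl⟩
    exact eq_top_iff.mpr fun a _ ↦ hker a (hmax _ hlt ▸ mem_top _)

/-- The idealizer of a left ideal. -/
def idealizer {T : Type*} [Ring T] (L : Ideal T) : Subring T where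
  carrier := {t | ∀ x ∈ L, x * t ∈ L}
  mul_mem' := fun ha hb x hx ↦ by simpa [mul_assoc] using hb _ (ha x hx)
  one_mem' := fun x hx ↦ by simpa using hx
  add_mem' := fun ha hb x hx ↦ by simpa [mul_add] using L.add_mem (ha x hx) (hb x hx)
  zero_mem' := fun x _ ↦ by simp
  neg_mem' := fun ha x hx ↦ by simpa using ha x hx

/-- The idealizer of a maximal left ideal is a maximal subring unless the ideal is two-sided. -/
theorem isTwoSided_of_isMaximal {T : Type*} [Ring T] (hT : ¬ ∃ S : Subring T, IsCoatom S)
    (L : Ideal T) [hL : L.IsMaximal] : L.IsTwoSided := by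
  by_contra hL2
  refine hT ⟨idealizer L, fun h ↦ hL2 ⟨fun b ha ↦ ?_⟩, fun U hU ↦ ?_⟩
  · exact (h ▸ mem_top b : b ∈ idealizer L) _ ha
  · obtain ⟨hle, t, htU, ht⟩ := SetLike.lt_iff_le_and_exists.mp hU
    have hLU : ∀ x ∈ L, x ∈ U := fun x hx ↦ hle fun y _ ↦ L.mul_mem_left y hx
    obtain ⟨x, hx, hxt⟩ : ∃ x ∈ L, x * t ∉ L := by
      by_contra! h
      exact ht h
    refine eq_top_iff.mpr fun r _ ↦ ?_
    obtain ⟨y, hy⟩ := Ideal.IsMaximal.exists_inv hL hxt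
    obtain ⟨i, hi, hyi⟩ := hy
    have hr : r = r * y * x * t + r * i := by
      rw [mul_assoc, mul_assoc, ← mul_add, hyi, mul_one]
    rw [hr]
    exact add_mem (mul_mem (hLU _ (L.mul_mem_left _ hx)) htU) (hLU _ (L.mul_mem_left _ hi))

open Polynomial in
/-- A noncommutative division ring algebraic over its center is finitely generated over the
centralizer of a noncentral element, hence has a maximal subring. -/
theorem exists_isCoatom_of_notMem_center {D : Type*} [Ring D] [Nontrivial D]
    (hD : ∀ x : D, x ≠ 0 → IsUnit x) (a : D) (ha : a ∉ center D)
    (hint : IsIntegral (center D) a) : ∃ S : Subring D, IsCoatom S := by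
  set B := centralizer ({a} : Set D) with hB
  have memB : ∀ {b : D}, b ∈ B ↔ a * b = b * a := by
    intro b
    simp [hB, mem_centralizer_iff]
  have hBtop : B ≠ ⊤ := by
    refine fun h ↦ ha (mem_center_iff.mpr fun b ↦ ?_)
    exact (memB.mp (h ▸ mem_top b)).symm
  -- A polynomial p acts by t ↦ ∑ pₙ t aⁿ. `I` collects those whose values all lie in one finitely
  -- generated extension of `B`.
  let I : D[X] → Prop := fun p ↦ ∃ s : Set D, s.Finite ∧ ∀ t, (p * C t).eval a ∈ B ⊔ closure s
  have I_C_mul : ∀ d p, I p → I (C d * p) := by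
    rintro d p ⟨s, hs, h⟩
    refine ⟨insert d s, hs.insert d, fun t ↦ ?_⟩
    rw [mul_assoc, eval_C_mul]
    exact mul_mem (le_sup_right (a := B) (subset_closure (Set.mem_insert _ _)))
      (sup_le_sup_left (closure_mono (Set.subset_insert _ _)) _ (h t))
  have I_mul_C : ∀ d p, I p → I (p * C d) := by
    rintro d p ⟨s, hs, h⟩
    refine ⟨s, hs, fun t ↦ ?_⟩
    rw [mul_assoc, ← C_mul]
    exact h _
  have I_sub : ∀ p q, I p → I q → I (p - q) := by
    rintro p q ⟨s, hs, h⟩ ⟨s', hs', h'⟩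
    refine ⟨s ∪ s', hs.union hs', fun t ↦ ?_⟩
    rw [sub_mul, eval_sub]
    exact sub_mem (sup_le_sup_left (closure_mono Set.subset_union_left) _ (h t))
      (sup_le_sup_left (closure_mono Set.subset_union_right) _ (h' t))
  set g := minpoly (center D) a with hg
  have hgm : g.Monic := minpoly.monic hint
  obtain ⟨z, hz⟩ := exists_X_sub_C_mul_add_C_of_center a g
  rw [hg, minpoly.aeval, C_0, add_zero, ← hg] at hz
  have hz0 : z ≠ 0 := by
    rintro rfl
    exact (hgm.map (algebraMap (center D) D)).ne_zero (by simpa using hz)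
  have hzdeg : z.natDegree < g.natDegree := by
    have := (monic_X_sub_C a).natDegree_mul' hz0
    rw [← hz, hgm.natDegree_map, natDegree_X_sub_C] at this
    omega
  -- Since (X - a) z t evaluates to t g(a) = 0 at a, every value of z commutes with a.
  have hzI : I z := by
    refine ⟨∅, Set.finite_empty, fun t ↦ le_sup_left (b := closure (∅ : Set D)) (memB.mpr ?_)⟩
    have h1 : ((X - C a) * (z * C t)).eval a = 0 := by
      rw [← mul_assoc, ← hz, map_center_mul_C, eval_C_mul, eval_map_algebraMap, hg,
        minpoly.aeval, mul_zero]
    rw [sub_mul, X_mul, eval_sub, eval_mul_X, eval_C_mul] at h1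
    exact (sub_eq_zero.mp h1).symm
  classical
  have hex : ∃ n, ∃ p : D[X], p ≠ 0 ∧ I p ∧ p.natDegree = n := ⟨_, z, hz0, hzI, rfl⟩
  obtain ⟨q, hq0, hqI, hqn⟩ := Nat.find_spec hex
  have hmin : ∀ p, p ≠ 0 → I p → q.natDegree ≤ p.natDegree := fun p hp hpI ↦
    hqn.trans_le (Nat.find_min' hex ⟨p, hp, hpI, rfl⟩)
  obtain ⟨u, hu⟩ := hD _ (leadingCoeff_ne_zero.mpr hq0)
  obtain ⟨p, hpm, hpI, hpn⟩ : ∃ p, p.Monic ∧ I p ∧ p.natDegree = q.natDegree := by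
    have hlc : (↑u⁻¹ : D) * q.leadingCoeff = 1 := by rw [← hu, Units.inv_mul]
    exact ⟨C (↑u⁻¹ : D) * q, monic_C_mul_of_mul_leadingCoeff_eq_one hlc, I_C_mul _ _ hqI,
      natDegree_C_mul_of_mul_ne_zero (by rw [hlc]; exact one_ne_zero)⟩
  -- The commutator lies in `I` and its top coefficient cancels, so minimality of the degree kills
  -- it.
  have hpcomm : ∀ d, C d * p = p * C d := by
    intro d
    by_contra hne
    have hne' : C d * p - p * C d ≠ 0 := sub_ne_zero.mpr hne
    have hle := hmin _ hne' (I_sub _ _ (I_C_mul d p hpI) (I_mul_C d p hpI))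
    rw [← hpn] at hle
    have hcoeff : (C d * p - p * C d).coeff p.natDegree = 0 := by
      simp [coeff_C_mul, coeff_mul_C, hpm.coeff_natDegree]
    have hle2 : (C d * p - p * C d).natDegree ≤ p.natDegree :=
      (natDegree_sub_le _ _).trans (max_le (natDegree_C_mul_le _ _) (natDegree_mul_C_le _ _))
    rw [hle2.antisymm hle |>.symm] at hcoeff
    exact hne' (leadingCoeff_eq_zero.mp hcoeff)
  have hpcoeff : (↑p.coeffs : Set D) ⊆ center D := by
    intro c hc
    obtain ⟨n, -, rfl⟩ := mem_coeffs_iff.mp hc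
    refine mem_center_iff.mpr fun d ↦ ?_
    have := congrArg (coeff · n) (hpcomm d)
    simpa [coeff_C_mul, coeff_mul_C] using this
  obtain ⟨P, hP⟩ : ∃ P : (center D)[X], P.map (algebraMap (center D) D) = p :=
    ⟨p.toSubring (center D) hpcoeff, map_toSubring ..⟩
  have hPm : P.Monic := by
    rw [← hP] at hpm
    exact monic_of_injective Subtype.val_injective hpm
  have hpa : p.eval a ≠ 0 := by
    intro h0
    rw [← hP, eval_map_algebraMap] at h0
    have h3 := natDegree_le_natDegree (minpoly.min (center D) a hPm h0)
    rw [← hPm.natDegree_map (algebraMap (center D) D), hP, ← hg] at h3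
    have := hmin z hz0 hzI
    omega
  obtain ⟨v, hv⟩ := hD _ hpa
  have hvB : (↑v⁻¹ : D) ∈ B := by
    have h1 : Commute a (v : D) := by
      rw [hv, ← hP, eval_map_algebraMap]
      have := congrArg (aeval a) (X_mul (p := P))
      rwa [map_mul, map_mul, aeval_X] at this
    exact memB.mpr h1.units_inv_right
  obtain ⟨s, hs, hsp⟩ := hpI
  -- As p is central, its value at t is t p(a), and p(a) is invertible in `B`.
  refine exists_isCoatom_of_sup_closure_eq_top hBtop hs (eq_top_iff.mpr fun t _ ↦ ?_)
  have := mul_mem (hsp t) (le_sup_left (b := closure s) hvB)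
  rwa [← hpcomm, eval_C_mul, ← hv, Units.mul_inv_cancel_right] at this

end Subring

/-! ### Pseudo-uniformizers in fields -/

namespace Subring

variable {K : Type*} [Field K]

/-- `x` is a nonunit of `V` and inverting it turns `V` into a field. -/
structure IsPseudoUniformizer (V : Subring K) (x : K) : Prop where
  mem : x ∈ V
  inv_notMem : x⁻¹ ∉ V
  exists_pow_mul_inv_mem : ∀ c ∈ V, ∃ n : ℕ, x ^ n * c⁻¹ ∈ V

theorem ne_zero_of_inv_notMem {V : Subring K} {x : K} (h : x⁻¹ ∉ V) : x ≠ 0 := by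
  rintro rfl
  exact h (by simp)

/-- A nonunit of a subring of a field remains a nonunit in some valuation subring. -/
theorem exists_valuationSubring_inv_notMem {R : Subring K} {x : K} (hx : x ∈ R) (hx' : x⁻¹ ∉ R) :
    ∃ W : ValuationSubring K, R ≤ W.toSubring ∧ x⁻¹ ∉ W := by
  have hx0 := ne_zero_of_inv_notMem hx'
  have htop : Ideal.span {(⟨x, hx⟩ : R)} ≠ ⊤ := by
    rw [Ne, Ideal.span_singleton_eq_top, isUnit_iff_exists_inv]
    rintro ⟨y, hy⟩
    have h1 : x * y = 1 := congrArg Subtype.val hy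
    exact hx' (by rw [inv_eq_of_mul_eq_one_right h1]; exact y.2)
  obtain ⟨W, hRW, hW⟩ := Ideal.image_subset_nonunits_valuationSubring _ htop
  refine ⟨W, hRW, (W.mem_nonunits_iff_or.mp
    (hW ⟨_, Ideal.mem_span_singleton_self _, rfl⟩)).resolve_left
    hx0⟩

section Algebraic

variable {A : Type*} [CommRing A] [Algebra A K] {W : ValuationSubring K} {x : K}

theorem _root_.ValuationSubring.mem_of_isIntegral_of_algebraMap_mem
    (hAW : ∀ a : A, algebraMap A K a ∈ W) {z : K} (hz : IsIntegral A z) : z ∈ W := by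
  have : IsIntegral W z := by
    obtain ⟨p, hp, hpz⟩ := hz
    refine ⟨p.map ((algebraMap A K).codRestrict W hAW), hp.map _, ?_⟩
    rw [Polynomial.eval₂_map]
    exact hpz
  obtain ⟨y, rfl⟩ := IsIntegrallyClosed.isIntegral_iff.mp this
  exact y.2

/-- If powers of `x` absorb denominators from `A` in the valuation ring `W`, then they also absorb
denominators of elements algebraic over `A`. -/
theorem exists_pow_mul_mem_of_isAlgebraic [FaithfulSMul A K]
    (hAW : ∀ a : A, algebraMap A K a ∈ W)
    (H : ∀ a : A, a ≠ 0 → ∃ n : ℕ, x ^ n * (algebraMap A K a)⁻¹ ∈ W) {z : K}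
    (hz : IsAlgebraic A z) : ∃ n : ℕ, x ^ n * z ∈ W := by
  obtain ⟨b, hb, hbz⟩ := hz.exists_integral_multiple
  obtain ⟨n, hn⟩ := H b hb
  have hb' : algebraMap A K b ≠ 0 := by simpa using hb
  refine ⟨n, ?_⟩
  have := W.mul_mem _ _ hn (ValuationSubring.mem_of_isIntegral_of_algebraMap_mem hAW hbz)
  rwa [Algebra.smul_def, mul_assoc, inv_mul_cancel_left₀ hb'] at this

theorem isPseudoUniformizer_inf_algebraicClosure [IsDomain A] [FaithfulSMul A K]
    (hAW : ∀ a : A, algebraMap A K a ∈ W) (hxW : x ∈ W) (hxW' : x⁻¹ ∉ W)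
    (hx : IsAlgebraic A x) (H : ∀ a : A, a ≠ 0 → ∃ n : ℕ, x ^ n * (algebraMap A K a)⁻¹ ∈ W) :
    (W.toSubring ⊓ (Subalgebra.algebraicClosure A K).toSubring).IsPseudoUniformizer x where
  mem := ⟨hxW, hx⟩
  inv_notMem h := hxW' h.1
  exists_pow_mul_inv_mem := by
    rintro c ⟨-, hc : IsAlgebraic A c⟩
    obtain ⟨n, hn⟩ := exists_pow_mul_mem_of_isAlgebraic hAW H hc.inv
    exact ⟨n, hn, (hx.pow n).mul hc.inv⟩

end Algebraic

section Base

variable {A : Type*} [CommRing A] [IsDomain A] [IsPrincipalIdealRing A] [Algebra A K]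
  [FaithfulSMul A K] {W : ValuationSubring K} {x : K}

open Polynomial in
-- Meant for i the first index whose coefficient g does not divide; r then has a unit constant term
-- in the valuation ring.
theorem _root_.Polynomial.exists_eq_C_mul_add_X_pow_mul {A : Type*} [CommSemiring A] {g : A} {i : ℕ}
    (f : A[X]) (h : ∀ j < i, g ∣ f.coeff j) :
    ∃ l r : A[X], f = C g * l + X ^ i * r ∧ r.coeff 0 = f.coeff i := by
  induction i generalizing f with
  | zero => exact ⟨0, f, by simp, rfl⟩
  | succ i ih =>
    obtain ⟨l, r, hf, hr⟩ := ih f.divX fun j hj ↦ by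
      rw [coeff_divX]
      exact h _ (by omega)
    obtain ⟨c, hc⟩ := h 0 (by omega)
    refine ⟨l * X + C c, r, ?_, by rw [hr, coeff_divX]⟩
    conv_lhs => rw [← divX_mul_X_add f, hf, hc, C_mul]
    ring

-- Let g generate the prime q = 𝔪_W ∩ A. Primitivity gives a first coefficient of f outside q, say
-- at i. Then 0 = g l(x) + xⁱ r(x) with r(x) a unit of W, because x ∈ 𝔪_W; so g divides xⁱ in W. As
-- x ≠ 0, g is a prime element, and a = gʲ b with b a unit of W.
open Polynomial in
theorem exists_pow_mul_inv_algebraMap_mem (hAW : ∀ a : A, algebraMap A K a ∈ W) (hxW : x ∈ W)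
    (hxW' : x⁻¹ ∉ W) {f : A[X]} (hf : f.IsPrimitive) (hfx : aeval x f = 0) (a : A) (ha : a ≠ 0) :
    ∃ n : ℕ, x ^ n * (algebraMap A K a)⁻¹ ∈ W := by
  have hx0 : x ≠ 0 := ne_zero_of_inv_notMem (V := W.toSubring) hxW'
  let φ : A →+* W := (algebraMap A K).codRestrict W hAW
  let q : Ideal A := (IsLocalRing.maximalIdeal W).comap φ
  have hq : q.IsPrime := Ideal.comap_isPrime φ _
  let xW : W := ⟨x, hxW⟩
  have hxm : xW ∈ IsLocalRing.maximalIdeal W := by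
    rw [IsLocalRing.mem_maximalIdeal, mem_nonunits_iff, isUnit_iff_exists_inv]
    rintro ⟨y, hy⟩
    have h1 : x * y = 1 := congrArg Subtype.val hy
    exact hxW' (by rw [inv_eq_of_mul_eq_one_right h1]; exact y.2)
  have hunit : ∀ b : A, b ∉ q → IsUnit (φ b) := fun b hb ↦ by
    by_contra h
    exact hb ((IsLocalRing.mem_maximalIdeal _).mpr h)
  have hunit' : ∀ w : W, IsUnit w → (w : K)⁻¹ ∈ W := by
    rintro w ⟨u, rfl⟩
    have h1 : ((u : W) : K) * ((↑u⁻¹ : W) : K) = 1 := congrArg Subtype.val u.mul_inv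
    rw [inv_eq_of_mul_eq_one_right h1]
    exact SetLike.coe_mem _
  obtain ⟨g, hg⟩ := (IsPrincipalIdealRing.principal q).principal
  rw [Ideal.submodule_span_eq] at hg
  have hex : ∃ i, f.coeff i ∉ q := by
    by_contra! h
    have : C g ∣ f := (C_dvd_iff_dvd_coeff _ _).mpr fun i ↦ by
      rw [← Ideal.mem_span_singleton, ← hg]
      exact h i
    exact hq.ne_top (by rw [hg]; exact Ideal.span_singleton_eq_top.mpr (hf g this))
  classical
  obtain ⟨i, hi, himin⟩ : ∃ i, f.coeff i ∉ q ∧ ∀ j < i, g ∣ f.coeff j :=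
    ⟨Nat.find hex, Nat.find_spec hex, fun j hj ↦ by
      rw [← Ideal.mem_span_singleton, ← hg]
      exact not_not.mp (Nat.find_min hex hj)⟩
  -- the powers of `x` are divisible by `g`
  obtain ⟨w, hw⟩ : φ g ∣ xW ^ i := by
    obtain ⟨l, r, hlr, hr⟩ := exists_eq_C_mul_add_X_pow_mul f himin
    have hroot : eval₂ φ xW f = 0 := by
      apply Subtype.val_injective
      change W.subtype (eval₂ φ xW f) = 0
      rw [hom_eval₂]
      exact hfx
    rw [hlr, eval₂_add, eval₂_mul, eval₂_mul, eval₂_C, eval₂_X_pow] at hroot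
    have hru : IsUnit (eval₂ φ xW r) := by
      have h1 : eval₂ φ xW r = eval₂ φ xW r.divX * xW + φ (f.coeff i) := by
        conv_lhs => rw [← divX_mul_X_add r, eval₂_add, eval₂_mul, eval₂_X, eval₂_C, hr]
      by_contra hn
      refine hi (?_ : φ (f.coeff i) ∈ IsLocalRing.maximalIdeal W)
      rw [← sub_eq_iff_eq_add'.mpr h1]
      exact sub_mem ((IsLocalRing.mem_maximalIdeal _).mpr hn) (Ideal.mul_mem_left _ _ hxm)
    obtain ⟨u, hu⟩ := hru
    refine (Units.dvd_mul_right (u := u)).mp ?_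
    rw [hu, ← neg_eq_of_add_eq_zero_right hroot]
    exact (dvd_mul_right _ _).neg_right
  have hw' : algebraMap A K g * w = x ^ i := (congrArg Subtype.val hw).symm
  have hg0 : g ≠ 0 := by
    rintro rfl
    rw [map_zero, zero_mul] at hw'
    exact pow_ne_zero _ hx0 hw'.symm
  have hgp : Prime g := (Ideal.span_singleton_prime hg0).mp (hg ▸ hq)
  obtain ⟨b, hab, hb⟩ :=
    (FiniteMultiplicity.of_prime_left hgp ha).exists_eq_pow_mul_and_not_dvd
  set j := multiplicity g a
  have hbq : b ∉ q := by rwa [hg, Ideal.mem_span_singleton]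
  have hmem := W.mul_mem _ _ (pow_mem w.2 j) (hunit' _ (hunit b hbq))
  refine ⟨i * j, ?_⟩
  have hg' : algebraMap A K g ≠ 0 := by simpa using hg0
  have heq : x ^ (i * j) * (algebraMap A K a)⁻¹ = (w : K) ^ j * (algebraMap A K b)⁻¹ := by
    rw [pow_mul, ← hw', hab, map_mul, map_pow, mul_inv, mul_pow]
    field_simp
  rw [heq]
  exact hmem

theorem exists_isPseudoUniformizer_of_isPrimitive (hAW : ∀ a : A, algebraMap A K a ∈ W)
    (hxW : x ∈ W) (hxW' : x⁻¹ ∉ W) {f : Polynomial A} (hf : f.IsPrimitive)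
    (hfx : Polynomial.aeval x f = 0) : ∃ V : Subring K, V.IsPseudoUniformizer x :=
  ⟨_, isPseudoUniformizer_inf_algebraicClosure hAW hxW hxW' ⟨f, hf.ne_zero, hfx⟩
    (exists_pow_mul_inv_algebraMap_mem hAW hxW hxW' hf hfx)⟩

open Polynomial in
theorem exists_isPseudoUniformizer_of_transcendental {F : Type*} [Field F] [Algebra F K] {x : K}
    (hx : Transcendental F x) : ∃ V : Subring K, V.IsPseudoUniformizer x := by
  have hx' : x⁻¹ ∉ (aeval x : F[X] →ₐ[F] K).range.toSubring := by
    rintro ⟨h, hh⟩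
    have hx0 : x ≠ 0 := by
      rintro rfl
      exact hx isAlgebraic_zero
    have h1 : aeval x (X * h - 1) = 0 := by
      have : aeval x h = x⁻¹ := hh
      rw [map_sub, map_mul, this, aeval_X, mul_inv_cancel₀ hx0, map_one, sub_self]
    have h2 := (transcendental_iff.mp hx _ h1)
    have := congrArg (coeff · 0) h2
    simp at this
  obtain ⟨W, hW, hxW'⟩ := exists_valuationSubring_inv_notMem
    (R := (aeval x : F[X] →ₐ[F] K).range.toSubring) ⟨X, aeval_X x⟩ hx'
  let : Algebra F[X] K := (aeval x : F[X] →ₐ[F] K).toRingHom.toAlgebra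
  have : FaithfulSMul F[X] K :=
    (faithfulSMul_iff_algebraMap_injective _ _).mpr (transcendental_iff_injective.mp hx)
  -- The inner `X` is the scalar acting as x, so x is a root of a monic polynomial over the base
  -- `F[X]`.
  refine exists_isPseudoUniformizer_of_isPrimitive (A := F[X]) (W := W) (fun a ↦ hW ⟨a, rfl⟩)
    (hW ⟨X, aeval_X x⟩) hxW' (f := X - C X) (monic_X_sub_C _).isPrimitive ?_
  rw [map_sub, aeval_X, aeval_C, sub_eq_zero]
  exact (aeval_X x).symm

-- If x is algebraic over 𝔽ₚ, then x⁻¹ ∈ 𝔽ₚ[x] ⊆ R, which is excluded. Otherwise the base ring is ℤ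
-- (x algebraic over ℚ) or F[x] with F the prime field.
open Polynomial in
theorem exists_isPseudoUniformizer {R : Subring K} {x : K} (hx : x ∈ R) (hx' : x⁻¹ ∉ R) :
    ∃ V : Subring K, V.IsPseudoUniformizer x := by
  obtain ⟨p, hp⟩ := CharP.exists K
  obtain hp' | rfl := CharP.char_is_prime_or_zero K p
  · have := Fact.mk hp'
    let := ZMod.algebra K p
    by_cases hal : IsAlgebraic (ZMod p) x
    · refine (hx' ?_).elim
      let R' : Subalgebra (ZMod p) K := { R with
        algebraMap_mem' := fun r ↦ by
          obtain ⟨n, rfl⟩ := ZMod.intCast_surjective r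
          rw [map_intCast]
          exact intCast_mem R n }
      have : Algebra.adjoin (ZMod p) {x} ≤ R' := Algebra.adjoin_le (Set.singleton_subset_iff.mpr hx)
      exact this hal.isIntegral.inv_mem_adjoin
    · exact exists_isPseudoUniformizer_of_transcendental hal
  · have := CharP.charP_to_charZero K
    by_cases hal : IsAlgebraic ℚ x
    · obtain ⟨W, hW, hxW'⟩ := exists_valuationSubring_inv_notMem hx hx'
      obtain ⟨f, hf0, hfx⟩ := (IsFractionRing.isAlgebraic_iff ℤ ℚ K).mpr hal
      exact exists_isPseudoUniformizer_of_isPrimitive (A := ℤ) (W := W)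
        (fun a ↦ by simp) (hW hx) hxW' f.isPrimitive_primPart
        (aeval_primPart_eq_zero hf0 hfx)
    · exact exists_isPseudoUniformizer_of_transcendental hal

end Base

end Subring

/-! ### Gauss extensions, and units in rings without maximal subrings -/

namespace Subring

variable {K : Type*} [Field K]

open Polynomial

/-- The Gauss extension: the quotients `f(y) / g(y)` of values of polynomials over `V` such that `g`
does not vanish under `ρ`. -/
def gaussExtension (V : Subring K) {k : Type*} [Field k] (ρ : V →+* k) (y : K) : Subring K where
  carrier := {z | ∃ f g : V[X], g.map ρ ≠ 0 ∧ z * aeval y g = aeval y f}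
  mul_mem' := by
    rintro a b ⟨f, g, hg, h⟩ ⟨f', g', hg', h'⟩
    refine ⟨f * f', g * g', by simpa using ⟨hg, hg'⟩, ?_⟩
    rw [map_mul, map_mul, ← h, ← h']
    ring
  one_mem' := ⟨1, 1, by simp, by simp⟩
  add_mem' := by
    rintro a b ⟨f, g, hg, h⟩ ⟨f', g', hg', h'⟩
    refine ⟨f * g' + f' * g, g * g', by simpa using ⟨hg, hg'⟩, ?_⟩
    rw [map_mul, map_add, map_mul, map_mul, ← h, ← h']
    ring
  zero_mem' := ⟨0, 1, by simp, by simp⟩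
  neg_mem' := by
    rintro a ⟨f, g, hg, h⟩
    exact ⟨-f, g, hg, by rw [map_neg, ← h, neg_mul]⟩

/-- Divide by a coefficient of largest valuation: the quotients lie in W and are algebraic over V.
-/
theorem exists_eq_C_mul_of_valuationSubring {V : Subring K} {W : ValuationSubring K}
    (hVW : ∀ z, z ∈ V ↔ z ∈ W ∧ IsAlgebraic V z) {f : V[X]} (hf : f ≠ 0) :
    ∃ (c : V) (g : V[X]) (i : ℕ), c ≠ 0 ∧ f = C c * g ∧ g.coeff i = 1 := by
  obtain ⟨i, hi, hmax⟩ := f.support.exists_max_image (fun i ↦ W.valuation (f.coeff i))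
    (support_nonempty.mpr hf)
  have hi0 : f.coeff i ≠ 0 := mem_support_iff.mp hi
  have hi0' : (f.coeff i : K) ≠ 0 := by simpa using hi0
  have hdvd : C (f.coeff i) ∣ f := by
    refine (C_dvd_iff_dvd_coeff _ _).mpr fun j ↦ ?_
    have hle : W.valuation (f.coeff j) ≤ W.valuation (f.coeff i) := by
      by_cases hj : j ∈ f.support
      · exact hmax j hj
      · simp [notMem_support_iff.mp hj]
    have hmem : (f.coeff j : K) * (f.coeff i : K)⁻¹ ∈ V := by
      refine (hVW _).mpr ⟨(W.valuation_le_one_iff _).mp ?_, ?_⟩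
      · rw [map_mul, map_inv₀]
        exact mul_inv_le_one_of_le₀ hle zero_le
      · exact (isAlgebraic_algebraMap (f.coeff j)).mul (isAlgebraic_algebraMap (f.coeff i)).inv
    refine ⟨⟨_, hmem⟩, Subtype.ext ?_⟩
    change (f.coeff j : K) = f.coeff i * (f.coeff j * (f.coeff i : K)⁻¹)
    field_simp
  obtain ⟨g, hg⟩ := hdvd
  refine ⟨f.coeff i, g, i, hi0, hg, mul_left_cancel₀ hi0 ?_⟩
  conv_rhs => rw [mul_one, hg, coeff_C_mul]

/-- If x⁻¹ = f/g then g = x f, which ρ kills. To invert f/g, write f = c f' with some coefficient of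
f' equal to 1: f' survives under ρ, and xⁿ absorbs c⁻¹. -/
theorem IsPseudoUniformizer.gaussExtension {V : Subring K} {x : K} (hV : V.IsPseudoUniformizer x)
    {W : ValuationSubring K} (hVW : ∀ z, z ∈ V ↔ z ∈ W ∧ IsAlgebraic V z) {k : Type*} [Field k]
    {ρ : V →+* k} (hρ : ρ ⟨x, hV.mem⟩ = 0) {y : K} (hy : Transcendental V y) :
    (V.gaussExtension ρ y).IsPseudoUniformizer x := by
  have hx0 := ne_zero_of_inv_notMem hV.inv_notMem
  have hinj := transcendental_iff_injective.mp hy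
  have hne : ∀ g : V[X], g ≠ 0 → aeval y g ≠ 0 := fun g hg h ↦
    hg (transcendental_iff.mp hy g h)
  refine ⟨⟨C ⟨x, hV.mem⟩, 1, by simp, by simp [aeval_C]; rfl⟩, ?_, ?_⟩
  · rintro ⟨f, g, hg, h⟩
    refine hg ?_
    have : g = C ⟨x, hV.mem⟩ * f := hinj (by
      rw [map_mul, ← h, aeval_C]
      change _ = x * _
      rw [mul_inv_cancel_left₀ hx0])
    rw [this, Polynomial.map_mul, map_C, hρ, C_0, zero_mul]
  · rintro z ⟨f, g, hg, h⟩
    by_cases hz : z = 0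
    · exact ⟨0, by simp [hz, zero_mem]⟩
    have hg0 : g ≠ 0 := by
      rintro rfl
      simp at hg
    have hf0 : f ≠ 0 := by
      rintro rfl
      rw [map_zero] at h
      exact mul_ne_zero hz (hne g hg0) h
    obtain ⟨c, f', i, hc, rfl, hi⟩ := exists_eq_C_mul_of_valuationSubring hVW hf0
    have hc' : (c : K) ≠ 0 := by simpa using hc
    obtain ⟨n, hn⟩ := hV.exists_pow_mul_inv_mem c c.2
    refine ⟨n, C ⟨_, hn⟩ * g, f', fun h0 ↦ ?_, ?_⟩
    · have := congrArg (coeff · i) h0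
      simp [hi] at this
    · rw [map_mul, aeval_C] at h ⊢
      change z * aeval y g = c * aeval y f' at h
      change x ^ n * z⁻¹ * aeval y f' = x ^ n * (c : K)⁻¹ * aeval y g
      field_simp
      rw [mul_comm, ← h]

/-- A nonunit of a subring of a field becomes a topologically nilpotent element of a subring which
together with its inverse generates the whole field. -/
theorem exists_forall_exists_pow_mul_mem {R : Subring K} {x : K} (hx : x ∈ R) (hx' : x⁻¹ ∉ R) :
    ∃ V : Subring K, x ∈ V ∧ x⁻¹ ∉ V ∧ ∀ z : K, ∃ n : ℕ, x ^ n * z ∈ V := by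
  obtain ⟨V₀, hV₀⟩ := exists_isPseudoUniformizer hx hx'
  obtain ⟨V, -, hV⟩ := zorn_le_nonempty₀ {V : Subring K | V.IsPseudoUniformizer x} (by
    intro c hc hchain y hy
    have hdir := hchain.directedOn
    have hmem := fun {z : K} ↦ mem_sSup_of_directedOn (x := z) ⟨y, hy⟩ hdir
    refine ⟨sSup c, ⟨hmem.mpr ⟨y, hy, (hc hy).mem⟩, fun h ↦ ?_, fun a ha ↦ ?_⟩,
      fun z hz ↦ le_sSup hz⟩
    · obtain ⟨U, hU, hxU⟩ := hmem.mp h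
      exact (hc hU).inv_notMem hxU
    · obtain ⟨U, hU, haU⟩ := hmem.mp ha
      obtain ⟨n, hn⟩ := (hc hU).exists_pow_mul_inv_mem a haU
      exact ⟨n, hmem.mpr ⟨U, hU, hn⟩⟩) V₀ hV₀
  have hVp : V.IsPseudoUniformizer x := hV.prop
  obtain ⟨W, hVW, hxW'⟩ := exists_valuationSubring_inv_notMem hVp.mem hVp.inv_notMem
  have hAW : ∀ a : V, algebraMap V K a ∈ W := fun a ↦ hVW a.2
  have H : ∀ a : V, a ≠ 0 → ∃ n : ℕ, x ^ n * (algebraMap V K a)⁻¹ ∈ W := fun a _ ↦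
    (hVp.exists_pow_mul_inv_mem a a.2).imp fun n hn ↦ hVW hn
  have halg : ∀ a ∈ V, IsAlgebraic V a := fun a ha ↦ isAlgebraic_algebraMap (⟨a, ha⟩ : V)
  have hmax := hV.eq_of_le (isPseudoUniformizer_inf_algebraicClosure hAW (hVW hVp.mem) hxW'
    (halg x hVp.mem) H) (fun a ha ↦ ⟨hVW ha, halg a ha⟩)
  have hVW' : ∀ z, z ∈ V ↔ z ∈ W ∧ IsAlgebraic V z := fun z ↦
    ⟨fun hz ↦ ⟨hVW hz, halg z hz⟩, fun hz ↦ by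
      rw [hmax]
      exact hz⟩
  refine ⟨V, hVp.mem, hVp.inv_notMem, fun z ↦ ?_⟩
  -- For transcendental z, the Gauss extension along the residue map of `W` would contain z and
  -- contradict maximality of `V`.
  have hz : IsAlgebraic V z := by
    by_contra hz
    let φ : V →+* W := (algebraMap V K).codRestrict W hAW
    let ρ : V →+* IsLocalRing.ResidueField W := (IsLocalRing.residue W).comp φ
    have hρ : ρ ⟨x, hVp.mem⟩ = 0 := by
      refine (IsLocalRing.residue_eq_zero_iff _).mpr ?_
      rw [IsLocalRing.mem_maximalIdeal, mem_nonunits_iff, isUnit_iff_exists_inv]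
      rintro ⟨w, hw⟩
      have h1 : x * w = 1 := congrArg Subtype.val hw
      exact hxW' (by rw [inv_eq_of_mul_eq_one_right h1]; exact w.2)
    have := hV.eq_of_le (hVp.gaussExtension hVW' hρ hz)
      (fun a ha ↦ ⟨C ⟨a, ha⟩, 1, by simp, by rw [map_one, mul_one, aeval_C]; rfl⟩)
    have hzV : z ∈ V := by
      rw [this]
      exact ⟨X, 1, by simp, by simp⟩
    exact hz (halg z hzV)
  obtain ⟨n, hn⟩ := exists_pow_mul_mem_of_isAlgebraic hAW H hz
  exact ⟨n, (hVW' _).mpr ⟨hn, ((halg x hVp.mem).pow n).mul hz⟩⟩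

/-- In a commutative ring without maximal subrings, units are inverted in every subring that
contains them. -/
theorem exists_mul_eq_one_of_mul_comm {T : Type*} [Ring T] (hcomm : ∀ a b : T, a * b = b * a)
    (hT : ¬ ∃ S : Subring T, IsCoatom S) (R : Subring T) {x : T} (hx : x ∈ R) (hxu : IsUnit x) :
    ∃ y ∈ R, x * y = 1 := by
  let _ : CommRing T := { ‹Ring T› with mul_comm := hcomm }
  by_contra! hne
  -- A prime avoiding 1 - xR keeps x noninvertible in the image of R.
  let M : Submonoid T :=
    { carrier := {t | ∃ r ∈ R, t = 1 - x * r}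
      one_mem' := ⟨0, zero_mem _, by simp⟩
      mul_mem' := by
        rintro _ _ ⟨r, hr, rfl⟩ ⟨s, hs, rfl⟩
        exact ⟨r + s - x * r * s, sub_mem (add_mem hr hs) (mul_mem (mul_mem hx hr) hs), by ring⟩ }
  have hM : Disjoint ((⊥ : Ideal T) : Set T) M := by
    rw [Set.disjoint_left]
    rintro a ha ⟨r, hr, har⟩
    rw [SetLike.mem_coe, Ideal.mem_bot] at ha
    exact hne r hr (sub_eq_zero.mp (har.symm.trans ha)).symm
  obtain ⟨Q, hQ, -, hQM⟩ := Ideal.exists_le_prime_disjoint ⊥ M hM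
  let K := FractionRing (T ⧸ Q)
  let φ : T →+* K := (algebraMap (T ⧸ Q) K).comp (Ideal.Quotient.mk Q)
  have hφ : ∀ t, φ t = 0 → t ∈ Q := fun t ht ↦ Ideal.Quotient.eq_zero_iff_mem.mp
    ((map_eq_zero_iff _ (IsFractionRing.injective (T ⧸ Q) K)).mp ht)
  obtain ⟨u, rfl⟩ := hxu
  have hinv : (φ u)⁻¹ = φ (↑u⁻¹ : T) := by
    refine inv_eq_of_mul_eq_one_right ?_
    rw [← map_mul, Units.mul_inv, map_one]
  have hφu : φ u ≠ 0 := (u.isUnit.map φ).ne_zero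
  obtain ⟨V, hV, hV', hK⟩ := exists_forall_exists_pow_mul_mem (K := K) (R := R.map φ) (x := φ u)
    ⟨u, hx, rfl⟩ (by
      rintro ⟨r, hr, hru⟩
      refine Set.disjoint_left.mp hQM (hφ (1 - u * r) ?_) ⟨r, hr, rfl⟩
      rw [map_sub, map_mul, hru, mul_inv_cancel₀ hφu, map_one, sub_self])
  refine hT (exists_isCoatom_of_sup_closure_eq_top (S := V.comap φ) (s := {(↑u⁻¹ : T)}) ?_
    (Set.finite_singleton _) (eq_top_iff.mpr fun t _ ↦ ?_))
  · intro h
    rw [hinv] at hV'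
    exact hV' (h ▸ mem_top (↑u⁻¹ : T) : (↑u⁻¹ : T) ∈ V.comap φ)
  · obtain ⟨n, hn⟩ := hK (φ t)
    have h1 : (u : T) ^ n * t ∈ V.comap φ := by
      rw [mem_comap, map_mul, map_pow]
      exact hn
    have h2 := mul_mem (pow_mem (le_sup_right (a := V.comap φ)
      (subset_closure (Set.mem_singleton (↑u⁻¹ : T)))) n) (le_sup_left (b := closure {(↑u⁻¹ : T)}) h1)
    rwa [← mul_assoc, ← mul_pow, Units.inv_mul, one_pow, one_mul] at h2

/-- In a ring integral over its center and without maximal subrings, commutators lie in all maximal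
left ideals. -/
theorem commutator_mem_of_isMaximal {T : Type*} [Ring T] (hint : ∀ t : T, IsIntegral (center T) t)
    (hT : ¬ ∃ S : Subring T, IsCoatom S) (L : Ideal T) [hL : L.IsMaximal] (a b : T) :
    a * b - b * a ∈ L := by
  have := isTwoSided_of_isMaximal hT L
  have hnt : Nontrivial (T ⧸ L) := Ideal.Quotient.nontrivial_iff.mpr hL.ne_top
  have hunit : ∀ x : T ⧸ L, x ≠ 0 → IsUnit x := fun x hx ↦ by
    obtain ⟨y, hy⟩ := Ideal.Quotient.exists_inv hx
    have hy0 : y ≠ 0 := by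
      rintro rfl
      simp at hy
    obtain ⟨z, hz⟩ := Ideal.Quotient.exists_inv hy0
    have hxz : x = z := by rw [← mul_one x, ← hz, ← mul_assoc, hy, one_mul]
    exact ⟨⟨x, y, hy, by rw [hxz, hz]⟩, rfl⟩
  have hsurj := Ideal.Quotient.mk_surjective (I := L)
  by_contra hab
  refine hT (exists_isCoatom_of_surjective (Ideal.Quotient.mk L) hsurj
    (exists_isCoatom_of_notMem_center hunit (Ideal.Quotient.mk L a) (fun ha ↦ hab ?_) ?_))
  · rw [← Ideal.Quotient.eq_zero_iff_mem, map_sub, map_mul, map_mul, sub_eq_zero]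
    exact (mem_center_iff.mp ha _).symm
  -- By surjectivity central elements stay central, so the integral equation of `a` descends.
  · let ψ : center T →+* center (T ⧸ L) :=
      ((Ideal.Quotient.mk L).comp (center T).subtype).codRestrict _ fun c ↦
        mem_center_iff.mpr fun y ↦ by
          obtain ⟨y, rfl⟩ := hsurj y
          change Ideal.Quotient.mk L y * Ideal.Quotient.mk L c = Ideal.Quotient.mk L c * _
          rw [← map_mul, ← map_mul, mem_center_iff.mp c.2 y]
    obtain ⟨p, hp, hpa⟩ := hint a
    refine ⟨p.map ψ, hp.map _, ?_⟩
    rw [eval₂_map]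
    have := hom_eval₂ p (algebraMap (center T) T) (Ideal.Quotient.mk L) a
    rw [hpa, map_zero] at this
    exact this.symm

/-- Units modulo a two-sided ideal with commutative quotient are inverted in every subring that
contains them, modulo the ideal, if there are no maximal subrings. -/
theorem exists_mul_sub_one_mem {T : Type*} [Ring T] (hT : ¬ ∃ S : Subring T, IsCoatom S)
    (I : Ideal T) [I.IsTwoSided] (hI : ∀ a b : T, a * b - b * a ∈ I) (R : Subring T) {x : T}
    (hx : x ∈ R) (hxu : IsUnit (Ideal.Quotient.mk I x)) : ∃ y ∈ R, y * x - 1 ∈ I := by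
  have hsurj := Ideal.Quotient.mk_surjective (I := I)
  obtain ⟨_, ⟨y, hy, rfl⟩, hxy⟩ := exists_mul_eq_one_of_mul_comm (T := T ⧸ I) (fun a b ↦ by
      obtain ⟨a, rfl⟩ := hsurj a
      obtain ⟨b, rfl⟩ := hsurj b
      rw [← map_mul, ← map_mul, Ideal.Quotient.mk_eq_mk_iff_sub_mem]
      exact hI a b)
    (fun h ↦ hT (exists_isCoatom_of_surjective _ hsurj h)) (R.map (Ideal.Quotient.mk I))
    ⟨x, hx, rfl⟩ hxu
  refine ⟨y, hy, ?_⟩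
  have h1 : x * y - 1 ∈ I := by
    rwa [← map_mul, ← map_one (Ideal.Quotient.mk I), Ideal.Quotient.mk_eq_mk_iff_sub_mem] at hxy
  simpa using I.add_mem (hI y x) h1

end Subring

/-! ### Jacobson radicals and the main theorem -/

theorem Ring.exists_mul_one_add_eq_one_of_mem_jacobson {R : Type*} [Ring R] {j : R}
    (hj : j ∈ Ring.jacobson R) : ∃ z, z * (1 + j) = 1 := by
  rw [← Ideal.jacobson_bot, Ideal.mem_jacobson_iff] at hj
  obtain ⟨z, hz⟩ := hj 1
  refine ⟨z, ?_⟩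
  rw [Ideal.mem_bot, mul_one, sub_eq_zero] at hz
  rw [mul_add, mul_one, add_comm, hz]

theorem proposition4p17 {T : Type*} [Ring T]
    (hT : ∀ t : T, IsIntegral (Subring.center T) t)
    (R : Subring T)
    (hR : (Ring.jacobson T : Set T) ∩ (R : Set T) ⊆ R.subtype '' (Ring.jacobson R : Set R)) :
    (∃ S : Subring T, IsCoatom S) ∨
      (R.subtype '' (Ring.jacobson R : Set R) = (Ring.jacobson T : Set T) ∩ (R : Set T) ∧
        R.subtype '' {x : R | IsUnit x} = {x : T | IsUnit x} ∩ (R : Set T)) := by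
  refine or_iff_not_imp_left.mpr fun hmax ↦ ⟨subset_antisymm ?_ hR, subset_antisymm ?_ ?_⟩
  · rintro _ ⟨r, hr, rfl⟩
    refine ⟨?_, r.2⟩
    rw [SetLike.mem_coe, Ring.jacobson_eq_sInf_isMaximal, Submodule.mem_sInf]
    intro L (hL : Ideal.IsMaximal L)
    have := Subring.isTwoSided_of_isMaximal hmax L
    have hcomm := Subring.commutator_mem_of_isMaximal hT hmax L
    by_contra hrL
    obtain ⟨y, hy⟩ := Ideal.Quotient.exists_inv (I := L) (a := Ideal.Quotient.mk L r)
      (fun h ↦ hrL (Ideal.Quotient.eq_zero_iff_mem.mp h))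
    obtain ⟨y, rfl⟩ := Ideal.Quotient.mk_surjective y
    have hyr : Ideal.Quotient.mk L y * Ideal.Quotient.mk L r = 1 := by
      rw [← hy, ← map_mul, ← map_mul, Ideal.Quotient.mk_eq_mk_iff_sub_mem]
      exact hcomm _ _
    obtain ⟨s, hs, hsr⟩ := Subring.exists_mul_sub_one_mem hmax L hcomm R r.2
      ⟨⟨_, _, hy, hyr⟩, rfl⟩
    -- 1 - sr lies in L, yet is left invertible because r ∈ J(R).
    obtain ⟨z, hz⟩ := Ring.exists_mul_one_add_eq_one_of_mem_jacobson
      ((Ring.jacobson R).neg_mem ((Ring.jacobson R).mul_mem_left ⟨s, hs⟩ hr))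
    refine hL.ne_top ((Ideal.eq_top_iff_one _).mpr ?_)
    have hz' : (z : T) * (1 + -(s * r)) = 1 := congrArg Subtype.val hz
    rw [← hz', show (1 : T) + -(s * r) = -(s * r - 1) by abel]
    exact Ideal.mul_mem_left L _ (L.neg_mem hsr)
  · rintro _ ⟨x, hx, rfl⟩
    exact ⟨hx.map R.subtype, x.2⟩
  · rintro x ⟨⟨u, rfl⟩, hxR⟩
    obtain ⟨y, hy, hyx⟩ := Subring.exists_mul_sub_one_mem hmax (Ring.jacobson T) (fun a b ↦ by
        rw [Ring.jacobson_eq_sInf_isMaximal, Submodule.mem_sInf]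
        intro L (hL : Ideal.IsMaximal L)
        exact Subring.commutator_mem_of_isMaximal hT hmax L a b) R hxR
      (u.isUnit.map (Ideal.Quotient.mk (Ring.jacobson T)))
    -- Here yu - 1 ∈ J(T) ∩ R ⊆ J(R), so yu has a left inverse in R.
    obtain ⟨j, hj, hjx⟩ := hR ⟨hyx, sub_mem (mul_mem hy hxR) (one_mem R)⟩
    obtain ⟨z, hz⟩ := Ring.exists_mul_one_add_eq_one_of_mem_jacobson hj
    have hzu : (z : T) * y * u = 1 := by
      have h1 : (z : T) * (1 + R.subtype j) = 1 := congrArg Subtype.val hz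
      rwa [hjx, add_sub_cancel, ← mul_assoc] at h1
    have hinv : (↑u⁻¹ : T) = z * y := (Units.mul_eq_one_iff_eq_inv.mp hzu).symm
    have huR : (↑u⁻¹ : T) ∈ R := hinv ▸ mul_mem z.2 hy
    exact ⟨⟨u, hxR⟩, ⟨⟨⟨u, hxR⟩, ⟨_, huR⟩, Subtype.ext u.mul_inv, Subtype.ext u.inv_mul⟩, rfl⟩,
      rfl⟩
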